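/- Call a nonempty subset $X$ of a finite abelian group $E$ *spectral* if there is a set $S$ of characters $E\to\mathbb{C}$ whose restrictions to $X$ form an orthogonal basis of $L^2(X)$ (with respect to counting measure). Let $p>3$ and $q>6p^4$ be primes, and put $G=\mathbb{Z}_6^5\times\mathbb{Z}_q$ and $H=\mathbb{Z}_p^4$. Let $B\subset H$ be a spectral set with $|B|=2p$, and let $v_1,v_2,v_3,v_4$ be a basis of the vector space $\mathbb{Z}_p^4$ over $\mathbb{Z}_p$. For a permutation $\pi\in S_5$ let $\pi(v)$ be the vector $v=(1,2,3,4,5)\in\mathbb{Z}_6^5$ with its coordinates permuted by $\pi$, and let $A_\pi=\{x\in\mathbb{Z}_6^5:\langle \pi(v),x\rangle\equiv 0 \bmod 6\}$. Let $\pi_0,\dots,\pi_{119}$ be any enumeration of $S_5$ and, identifying $\mathbb{Z}_q$ with $\{0,\dots,q-1\}$, let $$A=\bigcup_{k=0}^{119}\bigl(A_{\pi_k}\times\{k\}\bigr)\;\cup\;\bigcup_{k=120}^{q-1}\bigl(A_{\pi_0}\times\{k\}\bigr)\subset G .$$ Define $t:A\to H$ by $t(0,k)=v_k$ for $1\le k\le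 4$ and $t(a)=0$ for all other $a\in A$, and let $$P_t=\bigcup_{a\in A}\{a\}\times\bigl(t(a)+B\bigr)\subset G\times H .$$ Then $P_t$ is not spectral in $G\times H$. -/

import Mathlib

namespace LonelyWeakTile

/-- The restriction of a character of `E` to the subset `X`, as a function on `X`. -/
def restrict {E : Type*} [AddCommGroup E] (X : Finset E) (χ : AddChar E ℂ) : X → ℂ :=
  fun x => χ x

/-- `S` is a spectrum of the subset `X` of the finite abelian group `E`: the restrictions to `X`
of the characters in `S` are an orthogonal basis of the space `L²(X)` (counting measure).
Since characters of a finite group have absolute value one, these restrictions are nonzero when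
`X` is nonempty, so an orthogonal basis is a pairwise orthogonal family which spans. -/
def IsSpectrum {E : Type*} [AddCommGroup E] [Finite E] (X : Finset E)
    (S : Set (AddChar E ℂ)) : Prop :=
  (∀ χ ∈ S, ∀ ψ ∈ S, χ ≠ ψ → ∑ x ∈ X, χ x * (starRingEnd ℂ) (ψ x) = 0) ∧
    Submodule.span ℂ (restrict X '' S) = ⊤

/-- A subset of a finite abelian group is spectral if it is nonempty (that is, of positive Haar
measure) and has a spectrum. -/
def IsSpectral {E : Type*} [AddCommGroup E] [Finite E] (X : Finset E) : Prop :=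
  X.Nonempty ∧ ∃ S : Set (AddChar E ℂ), IsSpectrum X S

/-- The group `G = ℤ₆⁵ × ℤ_q`. -/
abbrev G (q : ℕ) : Type := (Fin 5 → ZMod 6) × ZMod q

/-- The group `H = ℤ_p⁴`. -/
abbrev H (p : ℕ) : Type := Fin 4 → ZMod p

/-- The vector `v = (1, 2, 3, 4, 5)` in `ℤ₆⁵`. -/
def baseVec : Fin 5 → ZMod 6 := ![1, 2, 3, 4, 5]

/-- The homomorphism `φ_σ(x) = ⟨σ(v), x⟩` from `ℤ₆⁵` to `ℤ₆`, where `σ(v)` is the vector `v` with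
its coordinates permuted by `σ`. -/
def phi (σ : Equiv.Perm (Fin 5)) : (Fin 5 → ZMod 6) →+ ZMod 6 where
  toFun x := ∑ i, baseVec (σ i) * x i
  map_zero' := by simp
  map_add' x y := by simp [mul_add, Finset.sum_add_distrib]

/-- The subgroup `A_k` of `ℤ₆⁵` used on the layer `k`, where `π` enumerates the 120
permutations: `ker φ_{π_k}` for `k < 120`, and `ker φ_{π_0}` for `k ≥ 120`. -/
def layer (π : Fin 120 ≃ Equiv.Perm (Fin 5)) (k : ℕ) : AddSubgroup (Fin 5 → ZMod 6) :=
  if h : k < 120 then (phi (π ⟨k, h⟩)).ker else (phi (π 0)).ker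

open Classical in
/-- The set `A`, the union over `0 ≤ k ≤ q - 1` of `A_k × {k}`. -/
noncomputable def setA (q : ℕ) [NeZero q] (π : Fin 120 ≃ Equiv.Perm (Fin 5)) : Finset (G q) :=
  Finset.univ.filter fun g => g.1 ∈ layer π g.2.val

open Classical in
/-- The set `P_t`, the union over `a ∈ A` of `{a} × (t(a) + B)`.  Only the values of `t` on `A`
matter. -/
noncomputable def shiftedProduct {G H : Type*} [AddCommGroup H]
    (A : Finset G) (B : Finset H) (t : G → H) : Finset (G × H) :=
  A.biUnion fun a => {a} ×ˢ B.image (fun b => t a + b)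

/-- The map `t` with `t(0, k) = v_k` for `1 ≤ k ≤ 4` and `t = 0` at all other points; the vectors
`v_1, v_2, v_3, v_4` are indexed here by `0, 1, 2, 3`. -/
def shift {p : ℕ} (q : ℕ) (v : Fin 4 → H p) (a : G q) : H p :=
  if h : a.1 = 0 ∧ 1 ≤ a.2.val ∧ a.2.val ≤ 4 then v ⟨a.2.val - 1, by omega⟩ else 0

end LonelyWeakTile

open LonelyWeakTile

/-! A spectrum of `P_t` would need `|P_t| = 1296 q · 2p` characters; orthogonality allows at most
`1280 q · 2p`. The transform of `P_t` at `(χ, ψ, η)` is the product of `∑_{a ∈ A} χψ(a) η(t(a))` and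
`∑_{b ∈ B} η(b)`. The shifts are chosen so that the first factor vanishes only if `η = 1`
(`eq_one_of_sum_setA_eq_zero`). Thus distinct third components in a spectrum are orthogonal on `B`,
and there are at most `2p` of them.

With the third component fixed, two distinct first components have a quotient that is nontrivial on
every `ker φ_σ`. Viewed as vectors of `ℤ₆⁵`, they never differ by `2σ(v)`. A packing argument with a
6 × 6 Hadamard matrix of cube roots of unity bounds such a set by `1280 < 6⁴` (`card_le_of_sub_ne`).
The second component takes at most `q` values. -/

namespace LonelyWeakTile

/-! ### Sets avoiding the differences `2 σ(v)` -/

/-- Six vectors in `ℤ₃⁵`, the logarithms of a `6 × 6` complex Hadamard matrix of cube roots of unity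
with its constant column removed. -/
def ternaryRow : Fin 6 → Fin 5 → ZMod 3 :=
  ![![0, 0, 0, 0, 0], ![0, 1, 1, 2, 2], ![1, 0, 2, 2, 1], ![1, 2, 0, 1, 2], ![2, 2, 1, 0, 1],
    ![2, 1, 2, 1, 0]]

-- Orthogonality of Hadamard rows makes each residue occur twice in a difference; without the
-- constant column, 0 occurs once and 1, 2 twice. This is also the distribution of `2v = (2, 4, 0,
-- 2, 4)` modulo 3.
set_option maxRecDepth 100000 in
theorem ternaryRow_sub : ∀ i j : Fin 6, i ≠ j → ∃ σ : Equiv.Perm (Fin 5), ∀ k,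
    ternaryRow j k - ternaryRow i k = ((2 * baseVec (σ k)).cast : ZMod 3) := by
  decide

theorem ternaryRow_injective : Function.Injective ternaryRow := by
  decide

theorem sub_eq_two_mul_of_cast_eq : ∀ a b c : ZMod 6, (a.cast : ZMod 2) = b.cast →
    (a.cast : ZMod 3) - b.cast = (2 * c).cast → a - b = 2 * c := by
  decide

theorem eq_of_cast_eq : ∀ a b : ZMod 6, (a.cast : ZMod 2) = b.cast →
    (a.cast : ZMod 3) = b.cast → a = b := by
  decide

/-- A set of vectors in `ℤ₆⁵` with no difference of the form `2 σ(v)` has at most `32 * 40` elements: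
within each class modulo `2` the translates of the six ternary rows are disjoint. -/
theorem card_le_of_sub_ne (V : Finset (Fin 5 → ZMod 6))
    (hV : ∀ y ∈ V, ∀ z ∈ V, y ≠ z → ∀ σ : Equiv.Perm (Fin 5),
      y - z ≠ fun k => 2 * baseVec (σ k)) : V.card ≤ 1280 := by
  classical
  have key : ∀ c ∈ (Finset.univ : Finset (Fin 5 → ZMod 2)),
      (V.filter fun y => (fun k => ((y k).cast : ZMod 2)) = c).card ≤ 40 := by
    intro c _
    set U := V.filter fun y => (fun k => ((y k).cast : ZMod 2)) = c with hU
    have hinj : Set.InjOn (fun s : (Fin 5 → ZMod 6) × Fin 6 =>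
        fun k => ((s.1 k).cast : ZMod 3) + ternaryRow s.2 k)
        (U ×ˢ (Finset.univ : Finset (Fin 6)) : Finset _) := by
      rintro ⟨y, i⟩ hy ⟨z, j⟩ hz h
      simp only [hU, Finset.coe_product, Set.mem_prod, Finset.mem_coe, Finset.mem_filter] at hy hz
      have h2 : ∀ k, ((y k).cast : ZMod 2) = (z k).cast := fun k =>
        congrFun (hy.1.2.trans hz.1.2.symm) k
      have h3 : ∀ k, ((y k).cast : ZMod 3) + ternaryRow i k = (z k).cast + ternaryRow j k :=
        fun k => congrFun h k
      by_cases hij : i = j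
      · subst hij
        have : y = z := funext fun k => eq_of_cast_eq _ _ (h2 k) (add_right_cancel (h3 k))
        rw [this]
      · exfalso
        obtain ⟨σ, hσ⟩ := ternaryRow_sub i j hij
        have hd : y - z = fun k => 2 * baseVec (σ k) := funext fun k =>
          sub_eq_two_mul_of_cast_eq _ _ _ (h2 k) (by rw [← hσ k]; linear_combination h3 k)
        by_cases hyz : y = z
        · subst hyz
          apply hij
          have hrow : ternaryRow i = ternaryRow j := funext fun k => add_left_cancel (h3 k)
          exact ternaryRow_injective hrow
        · exact hV y hy.1.1 z hz.1.1 hyz σ hd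
    -- Disjoint translates give `6|U| ≤ 3⁵ = 243`, so `|U| ≤ 40`.
    have hc := Finset.card_le_card_of_injOn (t := (Finset.univ : Finset (Fin 5 → ZMod 3))) _
      (fun _ _ => Finset.mem_univ _) hinj
    simp only [Finset.card_product, Finset.card_univ, Fintype.card_fin, Fintype.card_fun,
      ZMod.card] at hc
    omega
  have := Finset.card_le_mul_card_image_of_maps_to (s := V)
    (f := fun y => fun k => ((y k).cast : ZMod 2)) (t := Finset.univ)
    (fun _ _ => Finset.mem_univ _) 40 key
  simpa using this

/-! ### Characters -/

/-- The character `x ↦ exp (2πi ⟨y, x⟩ / 6)` of `ℤ₆⁵`. -/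
noncomputable def dotChar (y : Fin 5 → ZMod 6) : AddChar (Fin 5 → ZMod 6) ℂ :=
  ZMod.stdAddChar.compAddMonoidHom
    { toFun := fun x => ∑ i, y i * x i
      map_zero' := by simp
      map_add' := fun x z => by simp [mul_add, Finset.sum_add_distrib] }

theorem dotChar_apply (y x : Fin 5 → ZMod 6) :
    dotChar y x = ZMod.stdAddChar (∑ i, y i * x i) := rfl

theorem dotChar_bijective : Function.Bijective dotChar := by
  rw [Fintype.bijective_iff_injective_and_card]
  refine ⟨fun y z h => funext fun i => ?_, AddChar.card_eq.symm⟩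
  have := DFunLike.congr_fun h (Pi.single i 1)
  simpa [dotChar_apply, Pi.single_apply] using ZMod.injective_stdAddChar this

theorem dotChar_sub (y z : Fin 5 → ZMod 6) : dotChar (y - z) = dotChar y / dotChar z := by
  ext x
  rw [AddChar.div_apply', dotChar_apply, dotChar_apply, dotChar_apply, ← AddChar.map_sub_eq_div]
  simp [sub_mul]

/-- The character with vector `2σ(v)` factors through `φ_σ`, so it is trivial on `ker φ_σ`; the
packing bound then applies. -/
theorem card_characters_le (U : Finset (AddChar (Fin 5 → ZMod 6) ℂ))
    (hU : ∀ χ ∈ U, ∀ ψ ∈ U, χ ≠ ψ → ∀ σ, ¬ ∀ x ∈ (phi σ).ker, (χ / ψ) x = 1) :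
    U.card ≤ 1280 := by
  classical
  have hcard : (U.preimage dotChar dotChar_bijective.1.injOn).card = U.card := by
    rw [← Finset.card_image_of_injective _ dotChar_bijective.1,
      Finset.image_preimage_of_bij dotChar U (dotChar_bijective.bijOn_univ.subset_right
        (Set.subset_univ _) |> fun h => by simpa using h)]
  rw [← hcard]
  apply card_le_of_sub_ne
  intro y hy z hz hyz σ hd
  rw [Finset.mem_preimage] at hy hz
  refine hU _ hy _ hz (dotChar_bijective.1.ne hyz) σ fun x hx => ?_
  rw [← dotChar_sub, hd, dotChar_apply]
  have hx' : ∑ i, baseVec (σ i) * x i = 0 := hx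
  simp only [mul_assoc, ← Finset.mul_sum, hx', mul_zero, AddChar.map_zero_eq_one]

theorem phi_surjective (σ : Equiv.Perm (Fin 5)) : Function.Surjective (phi σ) := by
  intro c
  refine ⟨Pi.single (σ.symm 0) c, ?_⟩
  change ∑ i, baseVec (σ i) * (Pi.single (σ.symm 0) c : Fin 5 → ZMod 6) i = c
  simp [Pi.single_apply, baseVec]

theorem card_ker_phi (σ : Equiv.Perm (Fin 5)) : Nat.card (phi σ).ker = 1296 := by
  have h := (phi σ).ker.card_eq_card_quotient_mul_card_addSubgroup
  rw [Nat.card_congr (QuotientAddGroup.quotientKerEquivOfSurjective (phi σ)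
    (phi_surjective σ)).toEquiv] at h
  simp only [Nat.card_eq_fintype_card (α := Fin 5 → ZMod 6),
    Nat.card_eq_fintype_card (α := ZMod 6), Fintype.card_fun, ZMod.card, Fintype.card_fin] at h
  omega

/-- The kernels of the `φ_σ` generate `ℤ₆⁵`. -/
theorem eq_one_of_forall_ker (χ : AddChar (Fin 5 → ZMod 6) ℂ)
    (hχ : ∀ σ, ∀ x ∈ (phi σ).ker, χ x = 1) : χ = 1 := by
  obtain ⟨y, rfl⟩ := dotChar_bijective.2 χ
  have hy : ∀ (σ : Equiv.Perm (Fin 5)) (x : Fin 5 → ZMod 6), ∑ i, baseVec (σ i) * x i = 0 →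
      ∑ i, y i * x i = 0 := by
    intro σ x hx
    have := hχ σ x hx
    rw [dotChar_apply] at this
    exact ZMod.injective_stdAddChar (this.trans (AddChar.map_zero_eq_one _).symm)
  -- Placing the entry 2 of `v` at `i` puts `3eᵢ` in a kernel.
  have h3 : ∀ i, y i * 3 = 0 := by
    intro i
    have := hy (Equiv.swap i 1) (Pi.single i 3) (by
      simp [Pi.single_apply, baseVec]; decide)
    simpa [Pi.single_apply] using this
  -- Placing the entries 1 and 5 at `i` and `j` puts `eᵢ + eⱼ` in a kernel.
  have hs : ∀ i j, i ≠ j → y i + y j = 0 := by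
    intro i j hij
    obtain ⟨σ, h0, h4⟩ : ∃ σ : Equiv.Perm (Fin 5), σ i = 0 ∧ σ j = 4 := by
      refine ⟨(Equiv.swap i 0).trans (Equiv.swap (Equiv.swap i 0 j) 4), ?_, ?_⟩
      · revert i j; decide
      · simp
    have := hy σ (Pi.single i 1 + Pi.single j 1) (by
      simp [Pi.single_apply, mul_add, Finset.sum_add_distrib, h0, h4, baseVec]; decide)
    simpa [Pi.single_apply, mul_add, Finset.sum_add_distrib] using this
  have h0 : ∀ i, y i = 0 := by
    intro i
    obtain ⟨j, k, hij, hik, hjk⟩ : ∃ j k : Fin 5, i ≠ j ∧ i ≠ k ∧ j ≠ k := by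
      revert i; decide
    linear_combination h3 i - hs i j hij - hs i k hik + hs j k hjk
  have : y = 0 := funext h0
  subst this
  ext x
  simp [dotChar_apply]

/-- Characters that are pairwise orthogonal on `X` number at most `|X|`. -/
theorem card_le_of_orthogonal {E : Type*} [AddCommGroup E] [Finite E] {X : Finset E}
    (hX : X.Nonempty) (L : Finset (AddChar E ℂ))
    (hL : ∀ χ ∈ L, ∀ ψ ∈ L, χ ≠ ψ → ∑ x ∈ X, (χ / ψ) x = 0) : L.card ≤ X.card := by
  have horth : LinearIndependent ℂ fun χ : L =>
      (WithLp.toLp 2 (fun x : X => (χ : AddChar E ℂ) x) : EuclideanSpace ℂ X) := by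
    apply linearIndependent_of_ne_zero_of_inner_eq_zero
    · intro χ h
      obtain ⟨x, hx⟩ := hX
      have := congrArg (fun f : EuclideanSpace ℂ X => f ⟨x, hx⟩) h
      exact (AddChar.val_isUnit (χ : AddChar E ℂ) x).ne_zero this
    · intro χ ψ h
      have := hL ψ ψ.2 χ χ.2 (fun e => h (Subtype.ext e).symm)
      rw [PiLp.inner_apply, ← this, ← Finset.sum_coe_sort X]
      refine Finset.sum_congr rfl fun x _ => ?_
      simp [AddChar.div_apply, AddChar.map_neg_eq_conj]
  have := horth.fintype_card_le_finrank
  simpa using this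

/-- The kernel of `η` is a subgroup of a `ℤ_p`-space, hence a subspace. -/
theorem eq_one_of_basis {p : ℕ} [Fact p.Prime] (v : Module.Basis (Fin 4) (ZMod p) (H p))
    (η : AddChar (H p) ℂ) (h : ∀ i, η (v i) = 1) : η = 1 := by
  let K : Submodule (ZMod p) (H p) := AddSubgroup.toZModSubmodule p η.toAddMonoidHom.ker
  have hK : K = ⊤ := by
    rw [eq_top_iff, ← v.span_eq, Submodule.span_le]
    rintro _ ⟨i, rfl⟩
    exact h i
  ext x
  exact (hK ▸ Submodule.mem_top : x ∈ K)

/-! ### Galois conjugation -/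

/-- For `m` prime to `n`, `ω` and `ω ^ m` share their minimal polynomial over `ℤ`. -/
theorem _root_.IsPrimitiveRoot.aeval_pow_eq_zero {n : ℕ} (hn : 0 < n) {ω : ℂ}
    (hω : IsPrimitiveRoot ω n)
    {m : ℕ} (hm : m.Coprime n) {f : Polynomial ℤ} (hf : Polynomial.aeval ω f = 0) :
    Polynomial.aeval (ω ^ m) f = 0 := by
  have h := minpoly.isIntegrallyClosed_dvd (hω.isIntegral hn) hf
  rw [hω.minpoly_eq_pow_coprime hm] at h
  exact Polynomial.aeval_eq_zero_of_dvd_aeval_eq_zero h (minpoly.aeval _ _)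

/-- A vanishing sum `∑ (m_k + z_k) ψ(k)` with integers `m_k` and `p`-th roots of unity `z_k` stays
zero when the character `ψ` of `ℤ_q` is replaced by a conjugate. -/
theorem sum_mulShift_eq_zero {p q : ℕ} [NeZero p] [Fact q.Prime] (hpq : p.Coprime q)
    (ψ : AddChar (ZMod q) ℂ) (m : ZMod q → ℤ) (z : ZMod q → ℂ) (hz : ∀ k, z k ^ p = 1)
    (h : ∑ k, (m k + z k) * ψ k = 0) {j : ZMod q} (hj : j ≠ 0) :
    ∑ k, (m k + z k) * ψ (k * j) = 0 := by
  have hn : 0 < p * q := Nat.mul_pos (NeZero.pos p) (NeZero.pos q)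
  have hω := Complex.isPrimitiveRoot_exp (p * q) hn.ne'
  set ω := Complex.exp (2 * Real.pi * Complex.I / (p * q : ℕ))
  have hωp : IsPrimitiveRoot (ω ^ q) p := hω.pow hn (mul_comm p q)
  have hωq : IsPrimitiveRoot (ω ^ p) q := hω.pow hn rfl
  have hz' : ∀ k, ∃ i, (ω ^ q) ^ i = z k := fun k =>
    (hωp.eq_pow_of_pow_eq_one (hz k)).imp fun _ h => h.2
  choose e he using hz'
  have hψ' : ∀ k, ∃ i, (ω ^ p) ^ i = ψ k := fun k =>
    (hωq.eq_pow_of_pow_eq_one (by rw [← AddChar.map_nsmul_eq_pow]; simp)).imp fun _ h => h.2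
  choose c hc using hψ'
  let f : Polynomial ℤ := ∑ k, (Polynomial.C (m k) + Polynomial.X ^ (q * e k)) *
    Polynomial.X ^ (p * c k)
  have hf : Polynomial.aeval ω f = 0 := by
    rw [← h]
    simp [f, pow_mul, he, hc]
  -- The conjugation `ω ↦ ω ^ M` fixes the `p`-th roots of unity `z k` and sends `ψ k` to `ψ (k *
  -- j)`.
  obtain ⟨M, hMp, hMq⟩ := Nat.chineseRemainder hpq 1 j.val
  have hM : M.Coprime (p * q) := by
    refine Nat.Coprime.mul_right ?_ ?_
    · exact (hMp.gcd_eq.trans (Nat.gcd_one_left p))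
    · refine (hMq.gcd_eq.trans ?_)
      exact ZMod.val_coe_unit_coprime (Units.mk0 j hj)
  have := hω.aeval_pow_eq_zero hn hM hf
  rw [← this]
  simp only [f, map_sum, map_mul, map_add, map_pow, Polynomial.aeval_X, Polynomial.aeval_C]
  refine Finset.sum_congr rfl fun k _ => ?_
  have h1 : (ω ^ M) ^ (q * e k) = z k := by
    rw [← pow_mul, show M * (q * e k) = q * e k * M by ring, pow_mul, pow_mul, he]
    rw [pow_eq_pow_of_modEq hMp (hz k), pow_one]
  have h2 : (ω ^ M) ^ (p * c k) = ψ (k * j) := by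
    rw [← pow_mul, show M * (p * c k) = p * c k * M by ring, pow_mul, pow_mul, hc]
    rw [← AddChar.map_nsmul_eq_pow, nsmul_eq_mul, mul_comm]
    congr 2
    rw [(ZMod.natCast_eq_natCast_iff M j.val q).2 hMq, ZMod.natCast_zmod_val]
  rw [h1, h2]
  simp

/-- A function on `ℤ_q` is constant if its Fourier transform vanishes away from `0`. -/
theorem eq_of_sum_mulShift_eq_zero {q : ℕ} [Fact q.Prime] {ψ : AddChar (ZMod q) ℂ} (hψ : ψ ≠ 1)
    (a : ZMod q → ℂ) (h : ∀ j ≠ 0, ∑ k, a k * ψ (k * j) = 0) (l l' : ZMod q) : a l = a l' := by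
  have hprim := AddChar.IsPrimitive.of_ne_one hψ
  have key : ∀ l, (q : ℂ) * a l = ∑ k, a k := by
    intro l
    -- Fourier inversion at `l`.
    have h1 : ∑ j, ψ (j * (-l)) * ∑ k, a k * ψ (k * j) = (q : ℂ) * a l := by
      calc _ = ∑ k, a k * ∑ j, ψ (j * (k - l)) := by
            simp_rw [Finset.mul_sum]
            rw [Finset.sum_comm]
            refine Finset.sum_congr rfl fun k _ => Finset.sum_congr rfl fun j _ => ?_
            rw [show j * (k - l) = j * (-l) + k * j by ring, AddChar.map_add_eq_mul]
            ring
        _ = _ := by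
            simp_rw [AddChar.sum_mulShift _ hprim, sub_eq_zero]
            simp [mul_comm]
    rw [← h1, Finset.sum_eq_single 0]
    · simp
    · intro j _ hj
      rw [h j hj, mul_zero]
    · simp
  have hq0 : (q : ℂ) ≠ 0 := Nat.cast_ne_zero.2 (NeZero.ne q)
  exact mul_left_cancel₀ hq0 ((key l).trans (key l').symm)

/-! ### Zeros of the Fourier transform -/

theorem sum_addSubgroup_eq_ite {E : Type*} [AddCommGroup E] [Fintype E] (K : AddSubgroup E)
    [DecidablePred (· ∈ K)] (χ : AddChar E ℂ) [Decidable (∀ x ∈ K, χ x = 1)] :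
    (∑ x with x ∈ K, χ x) = if ∀ x ∈ K, χ x = 1 then (Nat.card K : ℂ) else 0 := by
  classical
  have h : (∑ x with x ∈ K, χ x) = ∑ x : K, (χ.compAddMonoidHom K.subtype) x := by
    simp only [AddChar.compAddMonoidHom_apply, AddSubgroup.subtype_apply]
    exact Finset.sum_subtype _ (by simp) _
  rw [h, AddChar.sum_eq_ite, Nat.card_eq_fintype_card]
  refine if_congr ?_ rfl rfl
  simp [AddChar.eq_zero_iff]

theorem card_layer (π : Fin 120 ≃ Equiv.Perm (Fin 5)) (k : ℕ) : Nat.card (layer π k) = 1296 := by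
  unfold layer
  split_ifs <;> exact card_ker_phi _

theorem card_setA (q : ℕ) [NeZero q] (π : Fin 120 ≃ Equiv.Perm (Fin 5)) :
    (setA q π).card = 1296 * q := by
  classical
  have h : ∀ k : ZMod q, (∑ x : Fin 5 → ZMod 6, if x ∈ layer π k.val then 1 else 0) = 1296 := by
    intro k
    rw [← Finset.card_filter, ← card_layer π k.val, Nat.card_eq_fintype_card,
      Fintype.card_subtype]
  rw [setA, Finset.card_filter, Fintype.sum_prod_type_right]
  simp only [h, Finset.sum_const, Finset.card_univ, ZMod.card, smul_eq_mul]
  exact mul_comm _ _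

theorem shift_of_ne_zero {p q : ℕ} (v : Fin 4 → H p) {x : Fin 5 → ZMod 6} (hx : x ≠ 0)
    (k : ZMod q) : shift q v (x, k) = 0 := by
  simp [shift, hx]

theorem shift_natCast {p q : ℕ} [NeZero q] (hq : 5 ≤ q) (v : Fin 4 → H p) (i : Fin 4) :
    shift q v (0, ((i + 1 : ℕ) : ZMod q)) = v i := by
  have hi : ((i + 1 : ℕ) : ZMod q).val = i + 1 := ZMod.val_natCast_of_lt (by omega)
  simp only [shift, hi]
  rw [dif_pos ⟨trivial, by omega, by omega⟩]
  rfl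

theorem shift_eq_zero {p q : ℕ} (v : Fin 4 → H p) (k : ZMod q)
    (hk : k.val = 0 ∨ 4 < k.val) : shift q v (0, k) = 0 := by
  simp only [shift]
  exact dif_neg (by omega)

open Classical in
/-- The Fourier coefficient of the layer `A_k` at `χ`. -/
noncomputable def layerCoeff (π : Fin 120 ≃ Equiv.Perm (Fin 5)) (χ : AddChar (Fin 5 → ZMod 6) ℂ)
    (k : ℕ) : ℤ :=
  if ∀ x ∈ layer π k, χ x = 1 then 1296 else 0

/-- In each layer only the origin can be shifted, so its term 1 in the layer sum is replaced by `η
(t(0, k))`. This gives the form integer plus `p`-th root of unity that Galois conjugation handles.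
-/
theorem sum_setA {p q : ℕ} [NeZero q] (π : Fin 120 ≃ Equiv.Perm (Fin 5)) (v : Fin 4 → H p)
    (χ : AddChar (Fin 5 → ZMod 6) ℂ) (ψ : AddChar (ZMod q) ℂ) (η : AddChar (H p) ℂ) :
    ∑ a ∈ setA q π, χ a.1 * ψ a.2 * η (shift q v a) =
      ∑ k : ZMod q, ((layerCoeff π χ k.val - 1 : ℤ) + η (shift q v (0, k))) * ψ k := by
  classical
  rw [setA, Finset.sum_filter, Fintype.sum_prod_type_right]
  refine Finset.sum_congr rfl fun k _ => ?_
  have h : ∀ x : Fin 5 → ZMod 6,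
      (if x ∈ layer π k.val then χ x * ψ k * η (shift q v (x, k)) else 0) =
        ψ k * ((if x ∈ layer π k.val then χ x else 0) +
          if x = 0 then η (shift q v (0, k)) - 1 else 0) := by
    intro x
    by_cases hx : x = 0
    · subst hx
      simp [(layer π k.val).zero_mem]
    · simp [hx, shift_of_ne_zero v hx k, mul_comm]
  simp only [h]
  rw [← Finset.mul_sum, Finset.sum_add_distrib, ← Finset.sum_filter, sum_addSubgroup_eq_ite,
    card_layer, Finset.sum_ite_eq' Finset.univ]
  simp only [layerCoeff, Finset.mem_univ, if_true]
  split_ifs <;> push_cast <;> ring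

theorem layerCoeff_eq_zero_or (π : Fin 120 ≃ Equiv.Perm (Fin 5)) (χ : AddChar (Fin 5 → ZMod 6) ℂ)
    (k : ℕ) : layerCoeff π χ k = 0 ∨ layerCoeff π χ k = 1296 := by
  unfold layerCoeff
  split_ifs <;> simp

theorem layer_symm (π : Fin 120 ≃ Equiv.Perm (Fin 5)) (σ : Equiv.Perm (Fin 5)) :
    layer π (π.symm σ) = (phi σ).ker := by
  simp [layer]

theorem eq_one_of_sum_eq_card {ι : Type*} (s : Finset ι) (z : ι → ℂ) (hz : ∀ i ∈ s, ‖z i‖ = 1)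
    (h : ∑ i ∈ s, (z i - 1) = 0) : ∀ i ∈ s, z i = 1 := by
  have hre : ∑ i ∈ s, (1 - (z i).re) = 0 := by
    have := congrArg Complex.re h
    simp only [Complex.re_sum, Complex.sub_re, Complex.one_re, Complex.zero_re] at this
    rw [← neg_eq_zero, ← Finset.sum_neg_distrib, ← this]
    exact Finset.sum_congr rfl fun _ _ => by ring
  intro i hi
  have h1 := (Finset.sum_eq_zero_iff_of_nonneg fun i hi => by
    linarith [Complex.re_le_norm (z i), hz i hi]).1 hre i hi
  have h2 : (z i).re = ‖z i‖ := by rw [hz i hi]; linarith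
  rw [Complex.re_eq_norm] at h2
  rw [Complex.eq_coe_norm_of_nonneg h2, hz i hi, Complex.ofReal_one]

/-- Let `m_k ∈ {0, 1296}` be the layer coefficients. If `ψ = 1`, the sum is `∑ m_k + ∑ (η(vᵢ) - 1)`,
whose second part has modulus at most 8; so every `m_k` is 0 and every `η(vᵢ)` is 1. If `ψ ≠ 1`,
conjugation and Fourier inversion make `m_k + η(t(0, k))` constant in `k`. Comparison with the
unshifted layer 0 gives `η(vᵢ) - 1 ∈ {0, ±1296}`, hence 0. Then `m_k` is constant, and the value
1296 would force `χ = 1` because the kernels generate. -/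
theorem eq_one_of_sum_setA_eq_zero {p q : ℕ} [Fact p.Prime] [Fact q.Prime] (hpq : p < q)
    (hq : 120 ≤ q) (π : Fin 120 ≃ Equiv.Perm (Fin 5)) (v : Module.Basis (Fin 4) (ZMod p) (H p))
    (χ : AddChar (Fin 5 → ZMod 6) ℂ) (ψ : AddChar (ZMod q) ℂ) (η : AddChar (H p) ℂ)
    (h : ∑ a ∈ setA q π, χ a.1 * ψ a.2 * η (shift q v a) = 0) :
    η = 1 ∧ (χ ≠ 1 → ∀ σ, ¬ ∀ x ∈ (phi σ).ker, χ x = 1) := by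
  classical
  have hval : ∀ n : ℕ, n < q → ((n : ZMod q)).val = n := fun n hn => ZMod.val_natCast_of_lt hn
  have hcast : ∀ i : Fin 4, η (shift q v (0, ((i + 1 : ℕ) : ZMod q))) = η (v i) := fun i => by
    rw [shift_natCast (by omega)]
  have hnorm : ∀ x, ‖η x‖ = 1 := fun x => AddChar.norm_apply η x
  rw [sum_setA] at h
  have hnone : (∀ k : ℕ, k < 120 → layerCoeff π χ k = 0) →
      ∀ σ, ¬ ∀ x ∈ (phi σ).ker, χ x = 1 := by
    intro hc σ hσ
    have := hc (π.symm σ) (π.symm σ).2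
    rw [layerCoeff, layer_symm, if_pos hσ] at this
    norm_num at this
  by_cases hψ : ψ = 1
  · subst hψ
    simp only [AddChar.one_apply, mul_one] at h
    have hz : ∀ k : ZMod q, k ∉ Finset.univ.image (fun i : Fin 4 => ((i + 1 : ℕ) : ZMod q)) →
        η (shift q v (0, k)) - 1 = 0 := by
      intro k hk
      rw [shift_eq_zero, AddChar.map_zero_eq_one, sub_self]
      by_contra hk'
      apply hk
      rw [Finset.mem_image]
      refine ⟨⟨k.val - 1, by omega⟩, Finset.mem_univ _, ?_⟩
      rw [show k.val - 1 + 1 = k.val by omega, ZMod.natCast_zmod_val]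
    have hinj : Set.InjOn (fun i : Fin 4 => ((i + 1 : ℕ) : ZMod q))
        (Finset.univ : Finset (Fin 4)) := by
      intro i _ j _ hij
      have := congrArg ZMod.val hij
      simp only [] at this
      rw [hval _ (by omega), hval _ (by omega)] at this
      exact Fin.ext (by omega)
    have hsum : ((∑ k : ZMod q, layerCoeff π χ k.val : ℤ) : ℂ) + ∑ i, (η (v i) - 1) = 0 := by
      rw [← h, ← Finset.sum_congr rfl fun i _ => congrArg (· - 1) (hcast i),
        ← Finset.sum_image (f := fun k => η (shift q v (0, k)) - 1) hinj,
        Finset.sum_subset (Finset.subset_univ _) fun k _ hk => hz k hk]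
      push_cast
      rw [← Finset.sum_add_distrib]
      exact Finset.sum_congr rfl fun _ _ => by ring
    have hnn : ∀ k ∈ (Finset.univ : Finset (ZMod q)), 0 ≤ layerCoeff π χ k.val := fun k _ => by
      rcases layerCoeff_eq_zero_or π χ k.val with h | h <;> omega
    have hzero : ∀ k : ZMod q, layerCoeff π χ k.val = 0 := by
      by_contra! hne
      obtain ⟨k, hk⟩ := hne
      have hge : (1296 : ℤ) ≤ ∑ k : ZMod q, layerCoeff π χ k.val := by
        rw [← (layerCoeff_eq_zero_or π χ k.val).resolve_left hk]
        exact Finset.single_le_sum hnn (Finset.mem_univ k)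
      have hle : ‖∑ i, (η (v i) - 1)‖ ≤ 8 := by
        refine (norm_sum_le _ _).trans ((Finset.sum_le_card_nsmul _ _ 2 fun i _ => ?_).trans ?_)
        · exact (norm_sub_le _ _).trans (by rw [hnorm, norm_one]; norm_num)
        · simp; norm_num
      rw [← norm_neg, ← eq_neg_of_add_eq_zero_left hsum, Complex.norm_intCast] at hle
      have : (1296 : ℝ) ≤ ((∑ k : ZMod q, layerCoeff π χ k.val : ℤ) : ℝ) := by exact_mod_cast hge
      linarith [le_abs_self ((∑ k : ZMod q, layerCoeff π χ k.val : ℤ) : ℝ)]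
    refine ⟨?_, fun _ => hnone fun k hk => ?_⟩
    · simp only [hzero, Finset.sum_const_zero, Int.cast_zero, zero_add] at hsum
      exact eq_one_of_basis v η fun i =>
        eq_one_of_sum_eq_card _ _ (fun i _ => hnorm _) hsum i (Finset.mem_univ i)
    · rw [← hzero k, hval k (by omega)]
  · have hcop : p.Coprime q := (Nat.coprime_primes Fact.out Fact.out).2 hpq.ne
    have hroot : ∀ k : ZMod q, η (shift q v (0, k)) ^ p = 1 := fun k => by
      rw [← AddChar.map_nsmul_eq_pow]
      simp
    have hconst := eq_of_sum_mulShift_eq_zero hψ _ fun j hj =>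
      sum_mulShift_eq_zero hcop ψ _ _ hroot h hj
    have hη : ∀ i, η (v i) = 1 := by
      intro i
      have h1 := hconst ((i + 1 : ℕ) : ZMod q) 0
      rw [hcast, shift_eq_zero v 0 (Or.inl ZMod.val_zero), AddChar.map_zero_eq_one] at h1
      have hn := hnorm (v i)
      rcases layerCoeff_eq_zero_or π χ ((i + 1 : ℕ) : ZMod q).val with e1 | e1 <;>
      rcases layerCoeff_eq_zero_or π χ (0 : ZMod q).val with e2 | e2 <;>
      rw [e1, e2] at h1 <;> push_cast at h1
      · linear_combination h1
      · have : η (v i) = (1297 : ℝ) := by push_cast; linear_combination h1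
        rw [this, Complex.norm_real] at hn
        norm_num at hn
      · have : η (v i) = (-1295 : ℝ) := by push_cast; linear_combination h1
        rw [this, Complex.norm_real] at hn
        norm_num at hn
      · linear_combination h1
    have hη1 := eq_one_of_basis v η hη
    refine ⟨hη1, fun hχ => ?_⟩
    have hc : ∀ k : ℕ, k < 120 → layerCoeff π χ k = layerCoeff π χ 0 := by
      intro k hk
      have h1 := hconst (k : ZMod q) 0
      rw [hη1, hval k (by omega), ZMod.val_zero] at h1
      simp only [AddChar.one_apply] at h1
      have h2 := add_right_cancel h1
      have h3 : layerCoeff π χ k - 1 = layerCoeff π χ 0 - 1 := by exact_mod_cast h2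
      omega
    rcases layerCoeff_eq_zero_or π χ 0 with h0 | h0
    · exact hnone fun k hk => (hc k hk).trans h0
    · refine absurd (eq_one_of_forall_ker χ fun σ => ?_) hχ
      have := (hc (π.symm σ) (π.symm σ).2).trans h0
      rw [layerCoeff, layer_symm] at this
      by_contra hcon
      rw [if_neg hcon] at this
      norm_num at this

/-! ### Counting the spectrum -/

theorem mem_shiftedProduct {G H : Type*} [AddCommGroup H] {A : Finset G} {B : Finset H}
    {t : G → H} {x : G × H} :
    x ∈ shiftedProduct A B t ↔ x.1 ∈ A ∧ ∃ b ∈ B, t x.1 + b = x.2 := by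
  classical
  obtain ⟨a, h⟩ := x
  simp only [shiftedProduct, Finset.mem_biUnion, Finset.mem_product, Finset.mem_singleton,
    Finset.mem_image]
  constructor
  · rintro ⟨a', ha', rfl, hb⟩
    exact ⟨ha', hb⟩
  · rintro ⟨ha, hb⟩
    exact ⟨a, ha, rfl, hb⟩

theorem sum_shiftedProduct {G H M : Type*} [AddCommGroup H] [AddCommMonoid M] (A : Finset G)
    (B : Finset H) (t : G → H) (f : G × H → M) :
    ∑ x ∈ shiftedProduct A B t, f x = ∑ a ∈ A, ∑ b ∈ B, f (a, t a + b) := by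
  classical
  rw [← Finset.sum_product']
  symm
  refine Finset.sum_bij (fun x _ => (x.1, t x.1 + x.2)) ?_ ?_ ?_ ?_
  · rintro ⟨a, b⟩ h
    rw [Finset.mem_product] at h
    exact mem_shiftedProduct.2 ⟨h.1, b, h.2, rfl⟩
  · rintro ⟨a, b⟩ _ ⟨a', b'⟩ _ h
    simp only [Prod.mk.injEq] at h
    obtain ⟨rfl, h⟩ := h
    rw [add_left_cancel h]
  · rintro ⟨a, c⟩ h
    obtain ⟨ha, b, hb, hc⟩ := mem_shiftedProduct.1 h
    exact ⟨(a, b), Finset.mem_product.2 ⟨ha, hb⟩, Prod.ext rfl hc⟩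
  · intros
    rfl

theorem card_shiftedProduct {G H : Type*} [AddCommGroup H] (A : Finset G) (B : Finset H)
    (t : G → H) : (shiftedProduct A B t).card = A.card * B.card := by
  rw [Finset.card_eq_sum_ones, sum_shiftedProduct]
  simp

theorem IsSpectrum.card_le {E : Type*} [AddCommGroup E] [Finite E] {X : Finset E}
    {S : Finset (AddChar E ℂ)} (h : IsSpectrum X S) : X.card ≤ S.card := by
  classical
  have h1 := finrank_span_le_card (R := ℂ) (restrict X '' (S : Set (AddChar E ℂ)))
  rw [h.2, finrank_top, Module.finrank_fintype_fun_eq_card, Fintype.card_coe] at h1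
  refine h1.trans ?_
  rw [Set.toFinset_image, Finset.toFinset_coe]
  exact Finset.card_image_le

theorem IsSpectrum.sum_div_eq_zero {E : Type*} [AddCommGroup E] [Finite E] {X : Finset E}
    {S : Set (AddChar E ℂ)} (h : IsSpectrum X S) {χ ψ : AddChar E ℂ} (hχ : χ ∈ S) (hψ : ψ ∈ S)
    (hne : χ ≠ ψ) : ∑ x ∈ X, (χ / ψ) x = 0 := by
  rw [← h.1 χ hχ ψ hψ hne]
  exact Finset.sum_congr rfl fun x _ => by rw [AddChar.div_apply, AddChar.map_neg_eq_conj]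

section Components

variable {L M N : Type*} [AddCommGroup L] [AddCommGroup M] [AddCommGroup N]

/-- The restriction of a character of `L × M × N` to the first factor. -/
def charFst (ξ : AddChar ((L × M) × N) ℂ) : AddChar L ℂ :=
  ξ.compAddMonoidHom ((AddMonoidHom.inl (L × M) N).comp (AddMonoidHom.inl L M))

/-- The restriction of a character of `L × M × N` to the second factor. -/
def charSnd (ξ : AddChar ((L × M) × N) ℂ) : AddChar M ℂ :=
  ξ.compAddMonoidHom ((AddMonoidHom.inl (L × M) N).comp (AddMonoidHom.inr L M))

/-- The restriction of a character of `L × M × N` to the third factor. -/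
def charThd (ξ : AddChar ((L × M) × N) ℂ) : AddChar N ℂ :=
  ξ.compAddMonoidHom (AddMonoidHom.inr (L × M) N)

theorem apply_eq_mul_components (ξ : AddChar ((L × M) × N) ℂ) (x : (L × M) × N) :
    ξ x = charFst ξ x.1.1 * charSnd ξ x.1.2 * charThd ξ x.2 := by
  simp only [charFst, charSnd, charThd, AddChar.compAddMonoidHom_apply, ← AddChar.map_add_eq_mul]
  simp

theorem charFst_div (ξ ζ : AddChar ((L × M) × N) ℂ) :
    charFst (ξ / ζ) = charFst ξ / charFst ζ := by
  ext
  simp [charFst, AddChar.div_apply']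

theorem charThd_div (ξ ζ : AddChar ((L × M) × N) ℂ) :
    charThd (ξ / ζ) = charThd ξ / charThd ζ := by
  ext
  simp [charThd, AddChar.div_apply']

end Components

theorem zero_of_sum_shiftedProduct {p q : ℕ} [Fact p.Prime] [Fact q.Prime] (hpq : p < q)
    (hq : 120 ≤ q) (B : Finset (H p)) (π : Fin 120 ≃ Equiv.Perm (Fin 5))
    (v : Module.Basis (Fin 4) (ZMod p) (H p)) (ξ : AddChar (G q × H p) ℂ)
    (h : ∑ x ∈ shiftedProduct (setA q π) B (shift q v), ξ x = 0) :
    ∑ b ∈ B, charThd ξ b = 0 ∨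
      charThd ξ = 1 ∧ (charFst ξ ≠ 1 → ∀ σ, ¬ ∀ x ∈ (phi σ).ker, charFst ξ x = 1) := by
  have hprod : (∑ a ∈ setA q π, charFst ξ a.1 * charSnd ξ a.2 * charThd ξ (shift q v a)) *
      ∑ b ∈ B, charThd ξ b = 0 := by
    rw [← h, sum_shiftedProduct, Finset.sum_mul_sum]
    refine Finset.sum_congr rfl fun a _ => Finset.sum_congr rfl fun b _ => ?_
    rw [apply_eq_mul_components ξ, AddChar.map_add_eq_mul]
    ring
  rcases mul_eq_zero.1 hprod with h0 | h0
  · exact Or.inr (eq_one_of_sum_setA_eq_zero hpq hq π v _ _ _ h0)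
  · exact Or.inl h0

end LonelyWeakTile

theorem lemma3p5 (p q : ℕ) [Fact p.Prime] [Fact q.Prime] (hp : 3 < p) (hq : 6 * p ^ 4 < q)
    (B : Finset (H p)) (hB : IsSpectral B) (hBcard : B.card = 2 * p)
    (π : Fin 120 ≃ Equiv.Perm (Fin 5)) (v : Module.Basis (Fin 4) (ZMod p) (H p)) :
    ¬ IsSpectral (shiftedProduct (setA q π) B (shift q v)) := by
  classical
  have hp4 : p ≤ p ^ 4 := Nat.le_self_pow (by norm_num) p
  have hp256 : 4 ^ 4 ≤ p ^ 4 := Nat.pow_le_pow_left hp 4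
  rintro ⟨-, S₀, hS₀⟩
  obtain ⟨S, rfl⟩ := (Set.toFinite S₀).exists_finset_coe
  have hzero : ∀ ξ ∈ S, ∀ ζ ∈ S, ξ ≠ ζ → _ := fun ξ hξ ζ hζ hne =>
    zero_of_sum_shiftedProduct (by omega) (by omega) B π v _ (hS₀.sum_div_eq_zero hξ hζ hne)
  -- Two members of the spectrum with equal third component cannot be orthogonal through the factor
  -- from `B`.
  have hB0 : ∑ b ∈ B, (1 : AddChar (H p) ℂ) b ≠ 0 := by
    simp only [AddChar.one_apply, Finset.sum_const, nsmul_eq_mul, mul_one]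
    exact_mod_cast (show B.card ≠ 0 by omega)
  have hthd : (S.image charThd).card ≤ 2 * p := by
    rw [← hBcard]
    refine card_le_of_orthogonal hB.1 _ fun η hη η' hη' hne => ?_
    obtain ⟨ξ, hξ, rfl⟩ := Finset.mem_image.1 hη
    obtain ⟨ζ, hζ, rfl⟩ := Finset.mem_image.1 hη'
    rw [← charThd_div]
    refine (hzero ξ hξ ζ hζ (fun e => hne (congrArg _ e))).resolve_right fun h => hne ?_
    rw [charThd_div] at h
    exact div_eq_one.1 h.1
  have hfiber : ∀ η ∈ S.image charThd, (S.filter fun ξ => charThd ξ = η).card ≤ q * 1280 := by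
    intro η _
    set T := S.filter fun ξ => charThd ξ = η with hT
    have hfst : (T.image charFst).card ≤ 1280 := by
      refine card_characters_le _ fun χ hχ χ' hχ' hne => ?_
      obtain ⟨ξ, hξ, rfl⟩ := Finset.mem_image.1 hχ
      obtain ⟨ζ, hζ, rfl⟩ := Finset.mem_image.1 hχ'
      rw [hT, Finset.mem_filter] at hξ hζ
      have h1 : charThd (ξ / ζ) = 1 := by rw [charThd_div, hξ.2, hζ.2, div_self']
      have h2 := ((hzero ξ hξ.1 ζ hζ.1 (fun e => hne (congrArg _ e))).resolve_left
        (by rwa [h1])).2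
      rw [charFst_div] at h2
      exact h2 (div_eq_one.not.2 hne)
    refine (Finset.card_le_mul_card_image T q fun χ _ => ?_).trans (Nat.mul_le_mul_left q hfst)
    have hinj : Set.InjOn (charSnd (L := Fin 5 → ZMod 6) (M := ZMod q) (N := H p))
        (T.filter fun ξ => charFst ξ = χ) := by
      intro ξ hξ ζ hζ h
      simp only [hT, Finset.coe_filter, Finset.mem_filter, Set.mem_ofPred_eq] at hξ hζ
      ext x
      rw [apply_eq_mul_components ξ, apply_eq_mul_components ζ, h, hξ.2, hζ.2, hξ.1.2, hζ.1.2]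
    have := Finset.card_le_card_of_injOn (t := Finset.univ) _ (fun _ _ => Finset.mem_univ _) hinj
    rwa [Finset.card_univ, AddChar.card_eq, ZMod.card] at this
  have hupper := Finset.card_le_mul_card_image S _ hfiber
  have hlower := hS₀.card_le
  rw [card_shiftedProduct, card_setA, hBcard] at hlower
  have : 1296 * q * (2 * p) ≤ q * 1280 * (2 * p) :=
    hlower.trans (hupper.trans (Nat.mul_le_mul_left _ hthd))
  have hpos : 0 < q * (2 * p) := Nat.mul_pos (by omega) (by omega)
  nlinarith
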